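/- Let $N$ be a finite-dimensional $C^\infty$ manifold (without boundary), $\pi:TN\to N$ its tangent bundle, $\mathcal V$ the vertical foliation of $TN$ (by the fibres, so $T\mathcal V=\ker d\pi$), and $S$ the canonical tangent structure of $TN$, $S(\partial/\partial x^i)=\partial/\partial y^i$, $S(\partial/\partial y^i)=0$ in natural coordinates $(x^i,y^i)$. For a smooth function (Lagrangian) $\mathcal L$ on an open set $U\subseteq TN$, let $(\mathrm{Hess}\,\mathcal L)_p(X,Y)=(S\tilde Y)(S\tilde X)\mathcal L|_p$, where $\tilde X,\tilde Y$ are extensions of $X,Y\in T_p(TN)$ to local $\mathcal V$-foliated (i.e. locally $\pi$-projectable) smooth vector fields; in natural coordinates this is $\frac{\partial^2\mathcal L}{\partial y^i\partial y^j}dx^i\otimes dx^j$. $\mathcal L$ is regular if $\mathrm{Hess}\,\mathcal L$ is nondegenerate on the transversal bundle $\nu\mathcal V=T(TN)/T\mathcal V$. Let $g$ be a smooth nondegenerate (not necessarily definite) section of $\odot^2\nu^*\mathcal V$ over $TN$, and assume that $g$ is a locally Lagrange metric: there are an open covering $TN=\bigcup_\alpha U_\alpha$ and regular Lagrangians $\mathcal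 L_\alpha$ on $U_\alpha$ with $g|_{U_\alpha}=\mathrm{Hess}\,\mathcal L_\alpha$ for all $\alpha$. Then $g$ is globally Lagrange: there is a regular Lagrangian $\mathcal L\in C^\infty(TN)$ with $g=\mathrm{Hess}\,\mathcal L$ on all of $TN$, and $\mathcal L$ is compatible with every local Lagrangian of $g$, i.e. for every open $U\subseteq TN$ and every regular Lagrangian $\mathcal L'$ on $U$ with $\mathrm{Hess}\,\mathcal L'=g|_U$, the difference $\mathcal L-\mathcal L'$ is, near every point of $U$, of the form $\varphi_i(x)y^i+b(x)$, with a smooth $1$-form $\varphi=\varphi_i dx^i$ and a smooth function $b$ on an open subset of $N$. -/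

import Mathlib

open Set Bundle Manifold
open scoped Manifold ContDiff

noncomputable section

namespace LagrangeGeometry

variable {E : Type*} [NormedAddCommGroup E] [NormedSpace ℝ E]
  {N : Type*} [TopologicalSpace N] [ChartedSpace E N] [IsManifold 𝓘(ℝ, E) ∞ N]

variable (E N) in
/-- The total space `TN` of the tangent bundle of a manifold `N` modelled on `E`. It is itself a
manifold, with model `𝓘(ℝ, E).tangent`. -/
abbrev TB : Type _ := TangentBundle 𝓘(ℝ, E) N

/-- The tangent space `T_p(TN)` at a point `p` of `TN`. -/
abbrev TTB (p : TB E N) : Type _ := TangentSpace 𝓘(ℝ, E).tangent p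

/-- The differential `T_p(TN) → T_{π p} N` of the projection `π : TN → N`. Its kernel is the
tangent space at `p` of the vertical foliation, i.e. of the foliation of `TN` by the fibres. -/
def dproj (p : TB E N) : TTB p →L[ℝ] TangentSpace 𝓘(ℝ, E) p.proj :=
  mfderiv 𝓘(ℝ, E).tangent 𝓘(ℝ, E) (fun q : TB E N => q.proj) p

/-- The inclusion in `TN` of the fibre `T_x N`, whose underlying vector space is `E`. -/
def fibreIncl (x : N) (w : E) : TB E N := ⟨x, w⟩

/-- The vertical lift `T_{π p} N → T_p(TN)`: the differential at `p` of the inclusion of the fibre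
through `p`. -/
def verticalLift (p : TB E N) : TangentSpace 𝓘(ℝ, E) p.proj →L[ℝ] TTB p :=
  mfderiv 𝓘(ℝ, E) 𝓘(ℝ, E).tangent (fibreIncl p.proj : E → TB E N) p.snd

/-- The canonical tangent structure `S` of `TN` (the vertical twisting homomorphism), with
`S (∂/∂xⁱ) = ∂/∂yⁱ` and `S (∂/∂yⁱ) = 0` in natural coordinates. -/
def tangentStructure (p : TB E N) : TTB p →L[ℝ] TTB p :=
  (verticalLift p).comp (dproj p)

/-- A smooth vector field `X` on the open set `V ⊆ TN` is foliated (projectable) with respect to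
the vertical foliation if locally it is `π`-related to a vector field on the base `N`. Only the
values of `X` on `V` matter. -/
def IsFoliatedOn (X : ∀ p : TB E N, TTB p) (V : Set (TB E N)) : Prop :=
  ContMDiffOn 𝓘(ℝ, E).tangent 𝓘(ℝ, E).tangent.tangent ∞
    (fun p => (⟨p, X p⟩ : TangentBundle 𝓘(ℝ, E).tangent (TB E N))) V ∧
  ∀ p ∈ V, ∃ W : Set (TB E N), IsOpen W ∧ p ∈ W ∧ W ⊆ V ∧
    ∃ Y : ∀ x : N, TangentSpace 𝓘(ℝ, E) x, ∀ q ∈ W, dproj q (X q) = Y q.proj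

/-- The derivative `(SX) f` of a function `f` in the direction of the vector field `SX`. -/
def derivS (X : ∀ p : TB E N, TTB p) (f : TB E N → ℝ) (p : TB E N) : ℝ :=
  (mfderiv 𝓘(ℝ, E).tangent 𝓘(ℝ, ℝ) f p : TTB p →L[ℝ] ℝ) (tangentStructure p (X p))

variable (E N) in
/-- Fields of continuous bilinear forms on the tangent spaces of `TN`, that is, (not necessarily
smooth) `2`-covariant tensor fields on `TN`. -/
abbrev BilinField : Type _ := ∀ p : TB E N, TTB p →L[ℝ] TTB p →L[ℝ] ℝ

/-- `g` is the Hessian of `L` on the open set `U ⊆ TN`: for tangent vectors `X_p`, `Y_p` at a point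
`p ∈ U` one has `g (X_p, Y_p) = (SY) (SX) L` at `p`, for all extensions `X`, `Y` of `X_p`, `Y_p` to
foliated vector fields near `p`. -/
def IsHessianOn (L : TB E N → ℝ) (U : Set (TB E N)) (g : BilinField E N) : Prop :=
  ∀ V : Set (TB E N), IsOpen V → V ⊆ U → ∀ X Y : ∀ p : TB E N, TTB p,
    IsFoliatedOn X V → IsFoliatedOn Y V →
      ∀ p ∈ V, g p (X p) (Y p) = derivS Y (derivS X L) p

/-- On `U`, the bilinear forms `g p` vanish on vertical vectors and induce nondegenerate forms on
the transversal spaces `T_p(TN) / ker dπ`. -/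
def IsTransversallyNondegenerateOn (g : BilinField E N) (U : Set (TB E N)) : Prop :=
  ∀ p ∈ U, ∀ X : TTB p, (∀ Y : TTB p, g p X Y = 0) ↔ dproj p X = 0

/-- A transversal metric of the vertical foliation of `TN`: a nondegenerate smooth section of the
bundle of symmetric bilinear forms on the transversal bundle `T(TN) / ker dπ`, seen as a symmetric
`2`-covariant tensor field on `TN`. No definiteness is required. -/
structure IsTransversalMetric (g : BilinField E N) : Prop where
  contMDiff : ContMDiff 𝓘(ℝ, E).tangent
    (𝓘(ℝ, E).tangent.prod 𝓘(ℝ, (E × E) →L[ℝ] (E × E) →L[ℝ] ℝ)) ∞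
    (fun p => TotalSpace.mk' ((E × E) →L[ℝ] (E × E) →L[ℝ] ℝ)
      (E := fun p : TB E N => TTB p →L[ℝ] TTB p →L[ℝ] ℝ) p (g p))
  symm : ∀ (p : TB E N) (X Y : TTB p), g p X Y = g p Y X
  nondegenerate : IsTransversallyNondegenerateOn g univ

/-- `L` is a regular (smooth) Lagrangian on the open set `U ⊆ TN`: its Hessian is nondegenerate on
the transversal bundle. -/
def IsRegularLagrangianOn (L : TB E N → ℝ) (U : Set (TB E N)) : Prop :=
  ContMDiffOn 𝓘(ℝ, E).tangent 𝓘(ℝ, ℝ) ∞ L U ∧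
  ∃ h : BilinField E N, IsHessianOn L U h ∧ IsTransversallyNondegenerateOn h U

/-- A locally Lagrange metric of `TN`: a transversal metric which, on the members of an open
covering of `TN`, is the Hessian of a regular Lagrangian. -/
def IsLocallyLagrange (g : BilinField E N) : Prop :=
  IsTransversalMetric g ∧
  ∀ p : TB E N, ∃ U : Set (TB E N), IsOpen U ∧ p ∈ U ∧
    ∃ L : TB E N → ℝ, IsRegularLagrangianOn L U ∧ IsHessianOn L U g

/-- Compatibility on `U` of two Lagrangians: locally `L - L' = a(φ) + b` with `φ` a foliated
`1`-form and `b` a foliated function, i.e. `φ` and `b` come from a smooth `1`-form `φᵢ dxⁱ` and a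
smooth function on an open subset of `N`, and `a(φ) = φᵢ yⁱ` is the evaluation of `φ` on the
points of `TN`. -/
def AreCompatibleOn (L L' : TB E N → ℝ) (U : Set (TB E N)) : Prop :=
  ∀ p ∈ U, ∃ W : Set (TB E N), IsOpen W ∧ p ∈ W ∧ W ⊆ U ∧
    ∃ (φ : ∀ x : N, TangentSpace 𝓘(ℝ, E) x →L[ℝ] ℝ) (b : N → ℝ),
      ContMDiffOn 𝓘(ℝ, E) (𝓘(ℝ, E).prod 𝓘(ℝ, E →L[ℝ] ℝ)) ∞
        (fun x => TotalSpace.mk' (E →L[ℝ] ℝ)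
          (E := fun x : N => TangentSpace 𝓘(ℝ, E) x →L[ℝ] ℝ) x (φ x))
        ((fun q : TB E N => q.proj) '' W) ∧
      ContMDiffOn 𝓘(ℝ, E) 𝓘(ℝ, ℝ) ∞ b ((fun q : TB E N => q.proj) '' W) ∧
      ∀ q ∈ W, L q - L' q = φ q.proj q.snd + b q.proj

/-- A globally Lagrange metric of `TN`: a transversal metric which is the Hessian of a global
regular Lagrangian, and this global Lagrangian is compatible with every local Lagrangian of the
metric. -/
def IsGloballyLagrange (g : BilinField E N) : Prop :=
  IsTransversalMetric g ∧
  ∃ L : TB E N → ℝ, IsRegularLagrangianOn L univ ∧ IsHessianOn L univ g ∧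
    ∀ (U : Set (TB E N)) (L' : TB E N → ℝ), IsOpen U →
      IsRegularLagrangianOn L' U → IsHessianOn L' U g → AreCompatibleOn L L' U

end LagrangeGeometry

end

noncomputable section

namespace LagrangeGeometry

/-! The Hessian sees only derivatives along the fibres. Since `S X` is the vertical lift of `dπ X`,
and `dπ X` is constant along a fibre for foliated `X`, `(SY)(SX)L` is the ordinary second derivative
of `L` restricted to the vector space `T_x N`, evaluated on `dπ Y` and `dπ X` (`isHessianOn_iff`).
As `dπ` is onto, the local Lagrangians give one bilinear form `G` on the fibres, independent of the
Lagrangian chosen (`IsLocallyLagrange.exists_fibreForm`).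

A fibre is convex, so two applications of the Poincaré lemma make `G` the second derivative of a
function on the whole fibre. That function is unique up to affine terms, and Taylor's formula
selects the one vanishing to second order at the origin, `∫₀¹ (1 - t) G(ty)(y, y) dt`
(`fderiv_fderiv_integral_eq`). The formula involves no choice, so the fibrewise solutions form a
single function on `TN` without any partition of unity; it is smooth by differentiation under the
integral sign (`contMDiff_fibreLagrangian`).

Two Lagrangians with the same Hessian differ by a function with zero second derivative along the
fibres, hence by a function that is locally affine in `y` with coefficients smooth in `x`
(`areCompatibleOn_of_fibreHess_eq`). -/

theorem two_le_infty : (2 : WithTop ℕ∞) ≤ ∞ :=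
  WithTop.coe_le_coe.2 (le_top : (2 : ℕ∞) ≤ ⊤)

/-! ### Smoothness of integrals depending on a parameter. -/

section Calculus

variable {P : Type*} [NormedAddCommGroup P] [NormedSpace ℝ P] [FiniteDimensional ℝ P]

open MeasureTheory in
/-- Differentiation under the integral sign for a smooth integrand. -/
theorem hasFDerivAt_intervalIntegral_of_contDiffOn {s : Set P} (hs : IsOpen s) {f : P × ℝ → ℝ}
    (hf : ContDiffOn ℝ ∞ f (s ×ˢ univ)) {p : P} (hp : p ∈ s) :
    HasFDerivAt (fun p => ∫ t in (0 : ℝ)..1, f (p, t))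
      (∫ t in (0 : ℝ)..1, (fderiv ℝ f (p, t)).comp (ContinuousLinearMap.inl ℝ P ℝ)) p := by
  have ho : IsOpen (s ×ˢ (univ : Set ℝ)) := hs.prod isOpen_univ
  have hf' : ContinuousOn (fun q => (fderiv ℝ f q).comp (ContinuousLinearMap.inl ℝ P ℝ))
      (s ×ˢ univ) :=
    (hf.continuousOn_fderiv_of_isOpen ho (by simp)).clm_comp continuousOn_const
  have hslice : ∀ x ∈ s, Continuous fun t : ℝ => (x, t) := fun x _ => by fun_prop
  have hmap : ∀ x ∈ s, ∀ t : ℝ, (x, t) ∈ s ×ˢ (univ : Set ℝ) := fun x hx t => ⟨hx, mem_univ t⟩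
  obtain ⟨r, hr, hrs⟩ := Metric.nhds_basis_closedBall.mem_iff.1 (hs.mem_nhds hp)
  have hK : IsCompact (Metric.closedBall p r ×ˢ Icc (0 : ℝ) 1) :=
    (isCompact_closedBall p r).prod isCompact_Icc
  -- The derivative is continuous on this compact set, so a constant dominates it.
  obtain ⟨C, hC⟩ := hK.exists_bound_of_continuousOn
    (hf'.mono (prod_mono hrs (subset_univ _)))
  refine intervalIntegral.hasFDerivAt_integral_of_dominated_of_fderiv_le
    (F := fun x t => f (x, t))
    (F' := fun x t => (fderiv ℝ f (x, t)).comp (ContinuousLinearMap.inl ℝ P ℝ))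
    (bound := fun _ => C) (Metric.closedBall_mem_nhds p hr) ?_ ?_ ?_ ?_ ?_ ?_
  · filter_upwards [hs.mem_nhds hp] with x hx
    exact (hf.continuousOn.comp_continuous (hslice x hx) (hmap x hx)).aestronglyMeasurable
  · exact (hf.continuousOn.comp_continuous (hslice p hp) (hmap p hp)).intervalIntegrable _ _
  · exact (hf'.comp_continuous (hslice p hp) (hmap p hp)).aestronglyMeasurable
  · refine .of_forall fun t ht x hx => hC (x, t) ⟨hx, ?_⟩
    rw [uIoc_of_le zero_le_one] at ht
    exact Ioc_subset_Icc_self ht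
  · exact intervalIntegrable_const
  · refine .of_forall fun t _ x hx => ?_
    have h := ((hf.contDiffAt (ho.mem_nhds (hmap x (hrs hx) t))).differentiableAt
      (by simp)).hasFDerivAt
    exact h.comp x (hasFDerivAt_prodMk_left x t)

/-- An integral depending smoothly on a parameter is a smooth function of the parameter. -/
theorem contDiffOn_intervalIntegral {s : Set P} (hs : IsOpen s) {f : P × ℝ → ℝ}
    (hf : ContDiffOn ℝ ∞ f (s ×ˢ univ)) :
    ContDiffOn ℝ ∞ (fun p => ∫ t in (0 : ℝ)..1, f (p, t)) s := by
  have ho : IsOpen (s ×ˢ (univ : Set ℝ)) := hs.prod isOpen_univ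
  refine contDiffOn_infty.2 fun n => ?_
  induction n generalizing f with
  | zero =>
    exact contDiffOn_zero.2 fun p hp =>
      (hasFDerivAt_intervalIntegral_of_contDiffOn hs hf hp).continuousAt.continuousWithinAt
  | succ n ih =>
    rw [Nat.cast_add_one]
    -- In finite dimension it is enough to test directional derivatives. The one along `v` is the
    -- integral of the derivative of `f` along `(v, 0)`, again a smooth real integrand, so the
    -- induction runs over all `f`.
    refine (contDiffOn_succ_iff_fderiv_apply hs.uniqueDiffOn).2 ⟨fun p hp =>
      (hasFDerivAt_intervalIntegral_of_contDiffOn hs hf hp).differentiableAt.differentiableWithinAt,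
      fun h => absurd h (by simp), fun v => ?_⟩
    have hg : ContDiffOn ℝ ∞ (fun q : P × ℝ => fderiv ℝ f q (v, 0)) (s ×ˢ univ) :=
      (hf.fderiv_of_isOpen ho (by simp)).clm_apply contDiffOn_const
    refine (ih hg).congr fun p hp => ?_
    rw [fderivWithin_of_isOpen hs hp,
      (hasFDerivAt_intervalIntegral_of_contDiffOn hs hf hp).fderiv,
      ContinuousLinearMap.intervalIntegral_apply]
    · simp
    · have hf' := ((hf.continuousOn_fderiv_of_isOpen ho (by simp)).clm_comp
        (continuousOn_const (c := ContinuousLinearMap.inl ℝ P ℝ)))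
      exact (hf'.comp_continuous (f := fun t : ℝ => (p, t)) (by fun_prop)
        fun t => ⟨hp, mem_univ t⟩).intervalIntegrable _ _

end Calculus

/-! ### Second derivatives on a vector space. -/

section Potential

variable {E : Type*} [NormedAddCommGroup E] [NormedSpace ℝ E]

/-- Taylor's formula of first order with integral remainder. -/
theorem eq_add_add_integral_of_hasFDerivAt {F : E → ℝ} {P : E → E →L[ℝ] ℝ}
    {G : E → E →L[ℝ] E →L[ℝ] ℝ} (hF : ∀ w, HasFDerivAt F (P w) w)
    (hP : ∀ w, HasFDerivAt P (G w) w) (hG : Continuous G) (y : E) :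
    F y = F 0 + P 0 y + ∫ t in (0 : ℝ)..1, (1 - t) * G (t • y) y y := by
  -- An antiderivative of the remainder: on differentiating, the two terms `P (t • y) y` cancel.
  have hd : ∀ t : ℝ, HasDerivAt (fun t : ℝ => F (t • y) + (1 - t) * P (t • y) y)
      ((1 - t) * G (t • y) y y) t := fun t => by
    have h0 : HasDerivAt (fun t : ℝ => t • y) y t := by
      simpa using (hasDerivAt_id t).smul_const y
    have h1 : HasDerivAt (fun t : ℝ => F (t • y)) (P (t • y) y) t :=
      (hF (t • y)).comp_hasDerivAt t h0
    have h2 : HasDerivAt (fun t : ℝ => P (t • y) y) (G (t • y) y y) t := by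
      exact (ContinuousLinearMap.apply ℝ ℝ y).hasFDerivAt.comp_hasDerivAt t
        ((hP (t • y)).comp_hasDerivAt t h0)
    have h3 := ((hasDerivAt_id' t).const_sub 1).fun_mul h2
    refine (h1.fun_add h3).congr_deriv ?_
    ring
  have hi := intervalIntegral.integral_eq_sub_of_hasDerivAt (a := 0) (b := 1)
    (fun t _ => hd t) (Continuous.intervalIntegrable (by fun_prop) _ _)
  rw [hi]
  simp

/-- A field of bilinear forms which is locally the second derivative of a smooth function on a
vector space is globally the second derivative of the function given by Taylor's formula. -/
theorem fderiv_fderiv_integral_eq {G : E → E →L[ℝ] E →L[ℝ] ℝ}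
    (h : ∀ w, ∃ f : E → ℝ, ContDiffAt ℝ ∞ f w ∧ G =ᶠ[nhds w] fderiv ℝ (fderiv ℝ f)) :
    fderiv ℝ (fderiv ℝ fun y => ∫ t in (0 : ℝ)..1, (1 - t) * G (t • y) y y) = G := by
  have hsm : ContDiff ℝ ∞ G := contDiff_iff_contDiffAt.2 fun w => by
    obtain ⟨f, hf, hfG⟩ := h w
    exact ((hf.fderiv_right (m := ∞) (by simp)).fderiv_right (m := ∞) (by simp)).congr_of_eventuallyEq
      hfG
  have hsymm : ∀ w a b, G w a b = G w b a := fun w a b => by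
    obtain ⟨f, hf, hfG⟩ := h w
    rw [hfG.self_of_nhds]
    exact hf.isSymmSndFDerivAt (by simpa using two_le_infty) a b
  have hsymm' : ∀ w a b, fderiv ℝ G w a b = fderiv ℝ G w b a := fun w a b => by
    obtain ⟨f, hf, hfG⟩ := h w
    rw [hfG.fderiv_eq]
    exact (hf.fderiv_right (m := ∞) (by simp)).isSymmSndFDerivAt (by simpa using two_le_infty) a b
  -- Poincaré lemma twice: symmetry of the third derivative makes `G` closed, giving `P` with
  -- derivative `G`; symmetry of `G` makes `P` closed, giving `F` with derivative `P`.
  obtain ⟨P, hP⟩ := convex_univ.exists_forall_hasFDerivAt_of_fderiv_symmetric isOpen_univ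
    (hsm.differentiable (by simp)).differentiableOn (fun w _ a b => hsymm' w a b)
  replace hP := fun w => hP w (mem_univ w)
  obtain ⟨F, hF⟩ := convex_univ.exists_forall_hasFDerivAt_of_fderiv_symmetric isOpen_univ
    (fun w _ => (hP w).differentiableAt.differentiableWithinAt)
    (fun w _ a b => by rw [(hP w).fderiv]; exact hsymm w a b)
  replace hF := fun w => hF w (mem_univ w)
  have heq : (fun y => ∫ t in (0 : ℝ)..1, (1 - t) * G (t • y) y y)
      = fun y => F y - F 0 - P 0 y := by
    funext y
    rw [eq_add_add_integral_of_hasFDerivAt hF hP hsm.continuous y]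
    ring
  have hd : fderiv ℝ (fun y => F y - F 0 - P 0 y) = fun y => P y - P 0 :=
    funext fun y => (((hF y).sub_const (F 0)).sub (P 0).hasFDerivAt).fderiv
  rw [heq, hd]
  exact funext fun y => ((hP y).sub_const (P 0)).fderiv

/-- A function with vanishing second derivative on a convex open set is affine. -/
theorem eq_add_fderiv_of_fderiv_fderiv_eq_zero {s : Set E} (hs : IsOpen s) (hc : Convex ℝ s)
    {f : E → ℝ} (hf : ContDiffOn ℝ ∞ f s) (h : ∀ w ∈ s, fderiv ℝ (fderiv ℝ f) w = 0)
    {w₀ w : E} (hw₀ : w₀ ∈ s) (hw : w ∈ s) :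
    f w = f w₀ + fderiv ℝ f w₀ (w - w₀) := by
  have hconst : ∀ w ∈ s, fderiv ℝ f w = fderiv ℝ f w₀ := fun w hw =>
    hs.is_const_of_fderiv_eq_zero hc.isPreconnected
      ((hf.fderiv_of_isOpen hs (m := ∞) (by simp)).differentiableOn (by simp)) h hw hw₀
  have hd : ∀ w ∈ s, HasFDerivAt (fun w => f w - fderiv ℝ f w₀ w) (0 : E →L[ℝ] ℝ) w :=
    fun w hw => by
    have h1 := ((hf.contDiffAt (hs.mem_nhds hw)).differentiableAt (by simp)).hasFDerivAt
    exact (h1.sub (fderiv ℝ f w₀).hasFDerivAt).congr_fderiv (by rw [hconst w hw, sub_self])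
  have := hs.is_const_of_fderiv_eq_zero hc.isPreconnected (𝕜 := ℝ)
    (fun w hw => (hd w hw).differentiableAt.differentiableWithinAt)
    (fun w hw => (hd w hw).fderiv) hw hw₀
  simp only [map_sub]
  linarith

end Potential

/-! ### Natural coordinates on the tangent bundle. -/

section Coordinates

variable {E : Type*} [NormedAddCommGroup E] [NormedSpace ℝ E]
  {N : Type*} [TopologicalSpace N] [ChartedSpace E N] [IsManifold 𝓘(ℝ, E) ∞ N]

/-- The natural chart of `TN` induced by the preferred chart of `N` at `x₀`. -/
def natChart (x₀ : N) : PartialEquiv (TB E N) (E × E) :=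
  extChartAt 𝓘(ℝ, E).tangent (⟨x₀, 0⟩ : TB E N)

/-- The fibre part of the natural chart at `x₀`, on the tangent space at `x`. -/
def fibreChart (x₀ x : N) : E →L[ℝ] E :=
  (trivializationAt E (TangentSpace 𝓘(ℝ, E) : N → Type _) x₀).continuousLinearMapAt ℝ x

/-- The inverse of `fibreChart x₀ x` for `x` in the domain of the chart at `x₀`. -/
def fibreChartSymm (x₀ x : N) : E →L[ℝ] E :=
  (trivializationAt E (TangentSpace 𝓘(ℝ, E) : N → Type _) x₀).symmL ℝ x

theorem mem_natChart_source {x₀ : N} {p : TB E N} :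
    p ∈ (natChart x₀).source ↔ p.proj ∈ (chartAt E x₀).source := by
  rw [natChart, extChartAt_source, TangentBundle.mem_chart_source_iff]

theorem natChart_target (x₀ : N) :
    (natChart x₀ : PartialEquiv (TB E N) (E × E)).target = (chartAt E x₀).target ×ˢ univ := by
  ext q
  have h := TangentBundle.mem_chart_target_iff (I := 𝓘(ℝ, E)) q (⟨x₀, 0⟩ : TB E N)
  rw [natChart, extChartAt_target]
  exact (and_iff_left (by simp)).trans (h.trans (and_iff_left (mem_univ q.2)).symm)

theorem natChart_apply {x₀ x : N} (hx : x ∈ (chartAt E x₀).source) (w : E) :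
    natChart x₀ (fibreIncl x w : TB E N) = (chartAt E x₀ x, fibreChart x₀ x w) := by
  have h : x ∈ (trivializationAt E (TangentSpace 𝓘(ℝ, E) : N → Type _) x₀).baseSet := hx
  exact Prod.ext rfl (congrFun (Bundle.Trivialization.coe_linearMapAt_of_mem (R := ℝ) _ h) w).symm

theorem fibreChart_fibreChartSymm {x₀ x : N} (hx : x ∈ (chartAt E x₀).source) (w : E) :
    fibreChart x₀ x (fibreChartSymm x₀ x w) = w :=
  Bundle.Trivialization.continuousLinearMapAt_symmL
    (trivializationAt E (TangentSpace 𝓘(ℝ, E) : N → Type _) x₀) hx w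

theorem fibreChartSymm_fibreChart {x₀ x : N} (hx : x ∈ (chartAt E x₀).source) (w : E) :
    fibreChartSymm x₀ x (fibreChart x₀ x w) = w :=
  Bundle.Trivialization.symmL_continuousLinearMapAt
    (trivializationAt E (TangentSpace 𝓘(ℝ, E) : N → Type _) x₀) hx w

theorem natChart_symm_fibreChart {x₀ x : N} (hx : x ∈ (chartAt E x₀).source) (w : E) :
    (natChart x₀).symm (chartAt E x₀ x, fibreChart x₀ x w) = (fibreIncl x w : TB E N) := by
  rw [← natChart_apply hx, (natChart x₀).left_inv (mem_natChart_source.2 hx)]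

theorem natChart_symm_apply {x₀ : N} {q : E × E} (hq : q.1 ∈ (chartAt E x₀).target) :
    (natChart x₀).symm q = (fibreIncl ((chartAt E x₀).symm q.1)
      (fibreChartSymm x₀ ((chartAt E x₀).symm q.1) q.2) : TB E N) := by
  have hx := (chartAt E x₀).map_target hq
  rw [← natChart_symm_fibreChart hx, fibreChart_fibreChartSymm hx, (chartAt E x₀).right_inv hq]

theorem isOpen_natChart_source (x₀ : N) :
    IsOpen (natChart x₀ : PartialEquiv (TB E N) (E × E)).source :=
  isOpen_extChartAt_source _

theorem isOpen_natChart_target (x₀ : N) :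
    IsOpen (natChart x₀ : PartialEquiv (TB E N) (E × E)).target :=
  isOpen_extChartAt_target _

theorem contMDiffOn_natChart (x₀ : N) :
    ContMDiffOn 𝓘(ℝ, E).tangent 𝓘(ℝ, E × E) ∞ (natChart x₀ : TB E N → E × E)
      (natChart x₀).source := by
  rw [natChart, extChartAt_source]
  exact contMDiffOn_extChartAt

theorem contMDiffOn_natChart_symm (x₀ : N) :
    ContMDiffOn 𝓘(ℝ, E × E) 𝓘(ℝ, E).tangent ∞ ((natChart x₀).symm : E × E → TB E N)
      (natChart x₀).target :=
  contMDiffOn_extChartAt_symm _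

theorem isOpen_natChart_target_inter {U : Set (TB E N)} (hU : IsOpen U) (x₀ : N) :
    IsOpen ((natChart x₀).target ∩ (natChart x₀).symm ⁻¹' U) :=
  (contMDiffOn_natChart_symm x₀).continuousOn.isOpen_inter_preimage (isOpen_natChart_target x₀) hU

theorem contDiffOn_comp_natChart_symm {f : TB E N → ℝ} {U : Set (TB E N)}
    (hf : ContMDiffOn 𝓘(ℝ, E).tangent 𝓘(ℝ, ℝ) ∞ f U) (x₀ : N) :
    ContDiffOn ℝ ∞ (f ∘ (natChart x₀).symm) ((natChart x₀).target ∩ (natChart x₀).symm ⁻¹' U) :=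
  contMDiffOn_iff_contDiffOn.1 <| hf.comp ((contMDiffOn_natChart_symm x₀).mono inter_subset_left)
    fun _ hq => hq.2

theorem contMDiff_fibreIncl (x : N) :
    ContMDiff 𝓘(ℝ, E) 𝓘(ℝ, E).tangent ∞ (fibreIncl x : E → TB E N) := by
  have hx := mem_chart_source E x
  have h : (fibreIncl x : E → TB E N)
      = (natChart x).symm ∘ fun w => (chartAt E x x, fibreChart x x w) :=
    funext fun w => (natChart_symm_fibreChart hx w).symm
  rw [h, ← contMDiffOn_univ]
  refine (contMDiffOn_natChart_symm x).comp (t := (natChart x).target) ?_ fun w _ => ?_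
  · exact (contDiff_const.prodMk (fibreChart x x).contDiff).contMDiff.contMDiffOn
  · rw [natChart_target]
    exact ⟨(chartAt E x).map_source hx, mem_univ _⟩

theorem contMDiff_proj : ContMDiff 𝓘(ℝ, E).tangent 𝓘(ℝ, E) ∞ (fun q : TB E N => q.proj) :=
  Bundle.contMDiff_proj (TangentSpace 𝓘(ℝ, E) : N → Type _)

end Coordinates

/-! ### Derivatives along the fibres. -/

section Hessian

variable {E : Type*} [NormedAddCommGroup E] [NormedSpace ℝ E]
  {N : Type*} [TopologicalSpace N] [ChartedSpace E N] [IsManifold 𝓘(ℝ, E) ∞ N]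

/-- The derivative of a function along the fibres of `TN`. -/
def fibreDeriv (f : TB E N → ℝ) (p : TB E N) : E →L[ℝ] ℝ :=
  fderiv ℝ (fun w : E => f (fibreIncl p.proj w)) p.snd

/-- The second derivative of a function along the fibres of `TN`. -/
def fibreHess (f : TB E N → ℝ) (p : TB E N) : E →L[ℝ] E →L[ℝ] ℝ :=
  fderiv ℝ (fderiv ℝ fun w : E => f (fibreIncl p.proj w)) p.snd

/-- The differential of the projection with values in the model space. -/
def dprojE (p : TB E N) : (E × E) →L[ℝ] E := dproj p

theorem isOpen_fibreIncl_preimage {U : Set (TB E N)} (hU : IsOpen U) (x : N) :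
    IsOpen ((fibreIncl x : E → TB E N) ⁻¹' U) :=
  hU.preimage (contMDiff_fibreIncl x).continuous

theorem contDiffOn_fibre {f : TB E N → ℝ} {U : Set (TB E N)}
    (hf : ContMDiffOn 𝓘(ℝ, E).tangent 𝓘(ℝ, ℝ) ∞ f U) (x : N) :
    ContDiffOn ℝ ∞ (fun w : E => f (fibreIncl x w)) (fibreIncl x ⁻¹' U) :=
  contMDiffOn_iff_contDiffOn.1 <|
    hf.comp (contMDiff_fibreIncl x).contMDiffOn fun _ hw => hw

/-- Chain rule: `S X` is the image of `dπ X` under the differential of the fibre inclusion. -/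
theorem derivS_fibreIncl {f : TB E N → ℝ} {x : N} {y : E}
    (hf : MDifferentiableAt 𝓘(ℝ, E).tangent 𝓘(ℝ, ℝ) f (fibreIncl x y))
    (X : ∀ p : TB E N, TTB p) :
    derivS X f (fibreIncl x y) = fderiv ℝ (fun w : E => f (fibreIncl x w)) y
      (dprojE (fibreIncl x y) (X (fibreIncl x y))) := by
  have h1 : HasMFDerivAt 𝓘(ℝ, E) 𝓘(ℝ, E).tangent (fibreIncl x : E → TB E N) y
      (verticalLift (fibreIncl x y)) :=
    ((contMDiff_fibreIncl x).mdifferentiable (by simp) y).hasMFDerivAt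
  let D : (E × E) →L[ℝ] ℝ := mfderiv 𝓘(ℝ, E).tangent 𝓘(ℝ, ℝ) f (fibreIncl x y)
  let V : E →L[ℝ] (E × E) := verticalLift (fibreIncl x y : TB E N)
  have h3 : HasFDerivAt (fun w : E => f (fibreIncl x w)) (D.comp V) y :=
    (hf.hasMFDerivAt.comp y h1).hasFDerivAt
  exact (congrArg (fun A : E →L[ℝ] ℝ => A (dprojE (fibreIncl x y) (X (fibreIncl x y))))
    h3.fderiv).symm

theorem derivS_eq {f : TB E N → ℝ} {p : TB E N}
    (hf : MDifferentiableAt 𝓘(ℝ, E).tangent 𝓘(ℝ, ℝ) f p) (X : ∀ p : TB E N, TTB p) :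
    derivS X f p = fibreDeriv f p (dprojE p (X p)) :=
  derivS_fibreIncl (E := E) (x := p.proj) (y := p.snd) hf X

/-- In the natural chart a fibre is the slice `w ↦ (const, linear in w)`, whose derivative along `u`
is `(0, fibreChart x₀ x u)`. -/
theorem fderiv_fibre_eq {f : TB E N → ℝ} {x₀ x : N} (hx : x ∈ (chartAt E x₀).source) {w : E}
    (hf : DifferentiableAt ℝ (f ∘ (natChart x₀).symm) (natChart x₀ (fibreIncl x w : TB E N)))
    (u : E) :
    fderiv ℝ (fun w : E => f (fibreIncl x w)) w u = fderiv ℝ (f ∘ (natChart x₀).symm)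
      (natChart x₀ (fibreIncl x w : TB E N)) (0, fibreChart x₀ x u) := by
  have h : (fun w : E => f (fibreIncl x w)) = (f ∘ (natChart x₀).symm) ∘
      fun w => (chartAt E x₀ x, fibreChart x₀ x w) :=
    funext fun w => by rw [Function.comp_apply, Function.comp_apply, natChart_symm_fibreChart hx]
  rw [natChart_apply hx] at hf ⊢
  have hd : HasFDerivAt (fun w => (chartAt E x₀ x, fibreChart x₀ x w))
      ((0 : E →L[ℝ] E).prod (fibreChart x₀ x)) w :=
    (hasFDerivAt_const _ _).prodMk (fibreChart x₀ x).hasFDerivAt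
  rw [h, (hf.hasFDerivAt.comp w hd).fderiv]
  rfl

theorem fibreDeriv_eq {f : TB E N → ℝ} {x₀ : N} {p : TB E N}
    (hp : p.proj ∈ (chartAt E x₀).source)
    (hf : DifferentiableAt ℝ (f ∘ (natChart x₀).symm) (natChart x₀ p)) (u : E) :
    fibreDeriv f p u
      = fderiv ℝ (f ∘ (natChart x₀).symm) (natChart x₀ p) (0, fibreChart x₀ p.proj u) :=
  fderiv_fibre_eq (E := E) (w := p.snd) hp hf u

end Hessian

/-! ### Foliated vector fields and the Hessian as a fibrewise second derivative. -/

section FoliatedFields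

variable {E : Type*} [NormedAddCommGroup E] [NormedSpace ℝ E]
  {N : Type*} [TopologicalSpace N] [ChartedSpace E N] [IsManifold 𝓘(ℝ, E) ∞ N]

theorem IsFoliatedOn.mono {X : ∀ p : TB E N, TTB p} {V W : Set (TB E N)}
    (hX : IsFoliatedOn X V) (hW : IsOpen W) (hWV : W ⊆ V) : IsFoliatedOn X W := by
  refine ⟨hX.1.mono hWV, fun p hp => ?_⟩
  obtain ⟨O, hO, hpO, -, Z, hZ⟩ := hX.2 p (hWV hp)
  exact ⟨O ∩ W, hO.inter hW, ⟨hpO, hp⟩, inter_subset_right, Z, fun q hq => hZ q hq.1⟩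

/-- The tangent map of `π` carries the section `X` to the smooth map `q ↦ (π q, dπ X_q)` into `TN`;
this is its fibre coordinate. -/
theorem contMDiffOn_fibreChart_dprojE {X : ∀ p : TB E N, TTB p} {U : Set (TB E N)}
    (hX : ContMDiffOn 𝓘(ℝ, E).tangent 𝓘(ℝ, E).tangent.tangent ∞
      (fun p => (⟨p, X p⟩ : TangentBundle 𝓘(ℝ, E).tangent (TB E N))) U) (x₀ : N) :
    ContMDiffOn 𝓘(ℝ, E).tangent 𝓘(ℝ, E) ∞
      (fun q => fibreChart x₀ q.proj (dprojE q (X q))) (U ∩ (natChart x₀).source) := by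
  have h1 : ContMDiffOn 𝓘(ℝ, E).tangent 𝓘(ℝ, E).tangent ∞
      (fun q : TB E N => (fibreIncl q.proj (dprojE q (X q)) : TB E N)) U :=
    (contMDiff_proj.contMDiff_tangentMap (m := ∞) (by simp)).comp_contMDiffOn hX
  have h2 : ContMDiffOn 𝓘(ℝ, E).tangent 𝓘(ℝ, E × E) ∞
      (fun q : TB E N => natChart x₀ (fibreIncl q.proj (dprojE q (X q)) : TB E N))
      (U ∩ (natChart x₀).source) :=
    (contMDiffOn_natChart x₀).comp (h1.mono inter_subset_left)
      fun q hq => mem_natChart_source.2 (mem_natChart_source.1 hq.2)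
  refine (contDiff_snd.contMDiff.comp_contMDiffOn h2).congr fun q hq => ?_
  rw [Function.comp_apply, natChart_apply (mem_natChart_source.1 hq.2)]

theorem contMDiffOn_derivS {f : TB E N → ℝ} {X : ∀ p : TB E N, TTB p} {U : Set (TB E N)}
    (hU : IsOpen U) (hf : ContMDiffOn 𝓘(ℝ, E).tangent 𝓘(ℝ, ℝ) ∞ f U)
    (hX : ContMDiffOn 𝓘(ℝ, E).tangent 𝓘(ℝ, E).tangent.tangent ∞
      (fun p => (⟨p, X p⟩ : TangentBundle 𝓘(ℝ, E).tangent (TB E N))) U) :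
    ContMDiffOn 𝓘(ℝ, E).tangent 𝓘(ℝ, ℝ) ∞ (derivS X f) U := by
  intro p hp
  have hO := isOpen_natChart_target_inter hU p.proj
  have hf' := contDiffOn_comp_natChart_symm hf p.proj
  have hpo : IsOpen (U ∩ (natChart p.proj : PartialEquiv (TB E N) (E × E)).source) :=
    hU.inter (isOpen_natChart_source p.proj)
  have hps : p ∈ (natChart p.proj : PartialEquiv (TB E N) (E × E)).source :=
    mem_natChart_source.2 (mem_chart_source E p.proj)
  have hmaps : MapsTo (natChart p.proj) (U ∩ (natChart p.proj).source)
      ((natChart p.proj).target ∩ (natChart p.proj).symm ⁻¹' U) := fun q hq =>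
    ⟨(natChart p.proj).map_source hq.2, by
      rw [mem_preimage, (natChart p.proj).left_inv hq.2]; exact hq.1⟩
  have h1 : ContMDiffOn 𝓘(ℝ, E).tangent 𝓘(ℝ, (E × E) →L[ℝ] ℝ) ∞
      (fun q => fderiv ℝ (f ∘ (natChart p.proj).symm) (natChart p.proj q))
      (U ∩ (natChart p.proj).source) :=
    (hf'.fderiv_of_isOpen hO (m := ∞) (by simp)).contMDiffOn.comp
      ((contMDiffOn_natChart p.proj).mono inter_subset_right) hmaps
  have h2 : ContMDiffOn 𝓘(ℝ, E).tangent 𝓘(ℝ, E × E) ∞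
      (fun q => ((0 : E), fibreChart p.proj q.proj (dprojE q (X q))))
      (U ∩ (natChart p.proj).source) :=
    (ContinuousLinearMap.inr ℝ E E).contDiff.contMDiff.comp_contMDiffOn
      (contMDiffOn_fibreChart_dprojE hX p.proj)
  have h3 := (h1.clm_apply h2).contMDiffAt (hpo.mem_nhds ⟨hp, hps⟩)
  refine (h3.congr_of_eventuallyEq ?_).contMDiffWithinAt
  filter_upwards [hpo.mem_nhds ⟨hp, hps⟩] with q hq
  rw [derivS_eq ((hf.contMDiffAt (hU.mem_nhds hq.1)).mdifferentiableAt (by simp)),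
    fibreDeriv_eq (mem_natChart_source.1 hq.2)]
  exact (hf'.contDiffAt (hO.mem_nhds (hmaps hq))).differentiableAt (by simp)

/-- Foliatedness enters here: along a fibre `dπ X` is locally a constant vector `z`, so
differentiating `(SX) f` produces no term with derivatives of `X`. -/
theorem derivS_derivS_fibreIncl {f : TB E N → ℝ} {X Y : ∀ p : TB E N, TTB p} {V : Set (TB E N)}
    (hV : IsOpen V) (hf : ContMDiffOn 𝓘(ℝ, E).tangent 𝓘(ℝ, ℝ) ∞ f V)
    (hX : IsFoliatedOn X V) {x : N} {y : E} (hp : (fibreIncl x y : TB E N) ∈ V) :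
    derivS Y (derivS X f) (fibreIncl x y) =
      fderiv ℝ (fderiv ℝ fun w : E => f (fibreIncl x w)) y
        (dprojE (fibreIncl x y) (Y (fibreIncl x y)))
        (dprojE (fibreIncl x y) (X (fibreIncl x y))) := by
  obtain ⟨W, hW, hpW, hWV, Z, hZ⟩ := hX.2 _ hp
  let z : E := Z x
  have hz : ∀ w : E, (fibreIncl x w : TB E N) ∈ W →
      dprojE (fibreIncl x w) (X (fibreIncl x w)) = z := fun w hw => hZ _ hw
  rw [derivS_fibreIncl (((contMDiffOn_derivS hV hf hX.1).contMDiffAt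
    (hV.mem_nhds hp)).mdifferentiableAt (by simp)), hz y hpW]
  have hWo := isOpen_fibreIncl_preimage hW x
  have heq : (fun w : E => derivS X f (fibreIncl x w)) =ᶠ[nhds y]
      fun w => fderiv ℝ (fun w : E => f (fibreIncl x w)) w z := by
    filter_upwards [hWo.mem_nhds hpW] with w hw
    rw [derivS_fibreIncl ((hf.contMDiffAt (hV.mem_nhds (hWV hw))).mdifferentiableAt (by simp)),
      hz w hw]
  have hd : DifferentiableAt ℝ (fderiv ℝ fun w : E => f (fibreIncl x w)) y :=
    (((contDiffOn_fibre hf x).contDiffAt ((isOpen_fibreIncl_preimage hV x).mem_nhds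
      hp)).fderiv_right (m := ∞) (by simp)).differentiableAt (by simp)
  rw [heq.fderiv_eq, fderiv_clm_apply hd (differentiableAt_const z)]
  simp

theorem derivS_derivS {f : TB E N → ℝ} {X Y : ∀ p : TB E N, TTB p} {V : Set (TB E N)}
    (hV : IsOpen V) (hf : ContMDiffOn 𝓘(ℝ, E).tangent 𝓘(ℝ, ℝ) ∞ f V)
    (hX : IsFoliatedOn X V) {p : TB E N} (hp : p ∈ V) :
    derivS Y (derivS X f) p = fibreHess f p (dprojE p (Y p)) (dprojE p (X p)) :=
  derivS_derivS_fibreIncl (E := E) (x := p.proj) (y := p.snd) hV hf hX hp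

/-- The vector field on `TN` with constant coefficients `c` in the natural chart at `x₀`. -/
def coordField (x₀ : N) (c : E × E) (q : TB E N) : TTB q :=
  (trivializationAt (E × E) (TangentSpace 𝓘(ℝ, E).tangent : TB E N → Type _)
    ⟨x₀, 0⟩).symmL ℝ q c

theorem coordField_eq {x₀ : N} {q : TB E N} (hq : q ∈ (natChart x₀).source) (c : E × E) :
    coordField x₀ c q
      = mfderiv 𝓘(ℝ, E × E) 𝓘(ℝ, E).tangent (natChart x₀).symm (natChart x₀ q) c := by
  have hq' : q ∈ (chartAt (ModelProd E E) (⟨x₀, 0⟩ : TB E N)).source := by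
    rwa [natChart, extChartAt_source] at hq
  have := TangentBundle.symmL_trivializationAt (I := 𝓘(ℝ, E).tangent) hq'
  rw [ModelWithCorners.Boundaryless.range_eq_univ, mfderivWithin_univ] at this
  exact congrArg (fun A : (E × E) →L[ℝ] (E × E) => A c) this

/-- In coordinates `π` is the first projection, so the result depends on `q` only through `q.proj`.
This is what makes coordinate fields foliated. -/
theorem dprojE_coordField {x₀ : N} {q : TB E N} (hq : q ∈ (natChart x₀).source) (c : E × E) :
    dprojE q (coordField x₀ c q) =
      (mfderiv 𝓘(ℝ, E) 𝓘(ℝ, E) (chartAt E x₀).symm (chartAt E x₀ q.proj) : E →L[ℝ] E) c.1 := by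
  rw [coordField_eq hq]
  have hqs := mem_natChart_source.1 hq
  have hqt : natChart x₀ q ∈ (natChart x₀ : PartialEquiv (TB E N) (E × E)).target :=
    (natChart x₀).map_source hq
  have ht := (isOpen_natChart_target x₀).mem_nhds hqt
  have h1 : HasMFDerivAt 𝓘(ℝ, E × E) 𝓘(ℝ, E).tangent (natChart x₀).symm (natChart x₀ q)
      (mfderiv 𝓘(ℝ, E × E) 𝓘(ℝ, E).tangent (natChart x₀).symm (natChart x₀ q)) :=
    (((contMDiffOn_natChart_symm x₀).contMDiffAt ht).mdifferentiableAt (by simp)).hasMFDerivAt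
  -- Stated for `q' = q` because the chain rule needs the derivative at `(natChart x₀).symm
  -- (natChart x₀ q)`, which equals `q` only propositionally.
  have h2 : ∀ q', q' = q →
      HasMFDerivAt 𝓘(ℝ, E).tangent 𝓘(ℝ, E) (fun q : TB E N => q.proj) q' (dprojE q) := by
    rintro _ rfl
    exact (contMDiff_proj.mdifferentiable (by simp) _).hasMFDerivAt
  have h3 := (h2 _ ((natChart x₀).left_inv hq)).comp _ h1
  have h4 : HasMFDerivAt 𝓘(ℝ, E) 𝓘(ℝ, E) (chartAt E x₀).symm (natChart x₀ q).1
      (mfderiv 𝓘(ℝ, E) 𝓘(ℝ, E) (chartAt E x₀).symm (chartAt E x₀ q.proj)) :=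
    (((contMDiffOn_chart_symm (I := 𝓘(ℝ, E)) (n := ∞)).contMDiffAt
      ((chartAt E x₀).open_target.mem_nhds
        ((chartAt E x₀).map_source hqs))).mdifferentiableAt (by simp)).hasMFDerivAt
  have h5 : HasMFDerivAt 𝓘(ℝ, E × E) 𝓘(ℝ, E) (Prod.fst : E × E → E) (natChart x₀ q)
      (ContinuousLinearMap.fst ℝ E E) :=
    hasMFDerivAt_iff_hasFDerivAt.2 hasFDerivAt_fst
  have h6 := h4.comp (natChart x₀ q) h5
  have heq : (fun q : TB E N => q.proj) ∘ (natChart x₀).symm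
      =ᶠ[nhds (natChart x₀ q)] (chartAt E x₀).symm ∘ Prod.fst := by
    filter_upwards [ht] with r hr
    rw [natChart_target] at hr
    simp only [Function.comp_apply]
    rw [natChart_symm_apply hr.1]
    rfl
  have h7 := hasMFDerivAt_unique h3 (h6.congr_of_eventuallyEq heq)
  exact congrArg (fun A : (E × E) →L[ℝ] E => A c) h7

theorem natChart_source_eq_baseSet (x₀ : N) :
    (natChart x₀ : PartialEquiv (TB E N) (E × E)).source =
      (trivializationAt (E × E) (TangentSpace 𝓘(ℝ, E).tangent : TB E N → Type _)
        ⟨x₀, 0⟩).baseSet := by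
  rw [natChart, extChartAt_source]
  rfl

theorem isFoliatedOn_coordField (x₀ : N) (c : E × E) :
    IsFoliatedOn (coordField x₀ c) (natChart x₀ : PartialEquiv (TB E N) (E × E)).source := by
  refine ⟨?_, fun p hp => ⟨_, isOpen_natChart_source x₀, hp, subset_rfl, fun x =>
    (mfderiv 𝓘(ℝ, E) 𝓘(ℝ, E) (chartAt E x₀).symm (chartAt E x₀ x) : E →L[ℝ] E) c.1,
    fun q hq => dprojE_coordField hq c⟩⟩
  let e := trivializationAt (E × E) (TangentSpace 𝓘(ℝ, E).tangent : TB E N → Type _) ⟨x₀, 0⟩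
  have h1 : ContMDiffOn (𝓘(ℝ, E).tangent.prod 𝓘(ℝ, E × E)) 𝓘(ℝ, E).tangent.tangent ∞
      e.toOpenPartialHomeomorph.symm e.target := e.contMDiffOn_symm
  rw [natChart_source_eq_baseSet]
  refine (h1.comp (s := e.baseSet) (contMDiffOn_id.prodMk (contMDiffOn_const (c := c)))
    fun q hq => e.mem_target.2 hq).congr fun q hq => ?_
  have hc : coordField x₀ c q = e.symm q c := e.symmL_apply hq c
  rw [hc]
  exact e.mk_symm hq c

/-- Every tangent vector thus extends to a foliated field, so `IsHessianOn` determines `g` on all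
tangent vectors. -/
theorem exists_coordField_eq (p : TB E N) (X : TTB p) : ∃ c, coordField p.proj c p = X :=
  ⟨_, Bundle.Trivialization.symmL_continuousLinearMapAt
    (trivializationAt (E × E) (TangentSpace 𝓘(ℝ, E).tangent : TB E N → Type _) ⟨p.proj, 0⟩)
    ((natChart_source_eq_baseSet (E := E) p.proj).subset
      (mem_natChart_source.2 (mem_chart_source E p.proj))) X⟩

theorem dprojE_surjective (p : TB E N) : Function.Surjective (dprojE p) := fun u => by
  have hp := mem_chart_source E p.proj
  have h := isInvertible_mfderivWithin_extChartAt_symm (I := 𝓘(ℝ, E)) (x := p.proj)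
    ((extChartAt 𝓘(ℝ, E) p.proj).map_source (mem_extChartAt_source p.proj))
  rw [ModelWithCorners.Boundaryless.range_eq_univ, mfderivWithin_univ] at h
  obtain ⟨a, ha⟩ := h.surjective u
  exact ⟨_, (dprojE_coordField (mem_natChart_source.2 hp) (a, 0)).trans ha⟩

/-- A field of bilinear forms is the Hessian of a smooth function exactly when it is given by the
second derivatives along the fibres. -/
theorem isHessianOn_iff {f : TB E N → ℝ} {U : Set (TB E N)} (hU : IsOpen U)
    (hf : ContMDiffOn 𝓘(ℝ, E).tangent 𝓘(ℝ, ℝ) ∞ f U) {g : BilinField E N} :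
    IsHessianOn f U g ↔
      ∀ p ∈ U, ∀ X Y : TTB p, g p X Y = fibreHess f p (dprojE p Y) (dprojE p X) := by
  constructor
  · intro h p hp X Y
    obtain ⟨c, rfl⟩ := exists_coordField_eq p X
    obtain ⟨d, rfl⟩ := exists_coordField_eq p Y
    have hV : IsOpen (U ∩ (natChart p.proj : PartialEquiv (TB E N) (E × E)).source) :=
      hU.inter (isOpen_natChart_source p.proj)
    have hpV : p ∈ U ∩ (natChart p.proj : PartialEquiv (TB E N) (E × E)).source :=
      ⟨hp, mem_natChart_source.2 (mem_chart_source E p.proj)⟩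
    have hfol := fun c => (isFoliatedOn_coordField p.proj c).mono hV
      (inter_subset_right (s := U))
    rw [h _ hV inter_subset_left _ _ (hfol c) (hfol d) p hpV,
      derivS_derivS hV (hf.mono inter_subset_left) (hfol c) hpV]
  · intro h V hV hVU X Y hX _ p hp
    rw [h p (hVU hp), derivS_derivS hV (hf.mono hVU) hX hp]

end FoliatedFields

/-! ### The global Lagrangian and its smoothness. -/

section GlobalLagrangian

variable {E : Type*} [NormedAddCommGroup E] [NormedSpace ℝ E]
  {N : Type*} [TopologicalSpace N] [ChartedSpace E N] [IsManifold 𝓘(ℝ, E) ∞ N]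

/-- A field of bilinear forms on the fibres of `TN` which is locally the fibrewise second derivative
of a smooth function. -/
def IsLocallyFibreHess (G : TB E N → E →L[ℝ] E →L[ℝ] ℝ) : Prop :=
  ∀ p, ∃ U : Set (TB E N), IsOpen U ∧ p ∈ U ∧ ∃ f : TB E N → ℝ,
    ContMDiffOn 𝓘(ℝ, E).tangent 𝓘(ℝ, ℝ) ∞ f U ∧ ∀ q ∈ U, G q = fibreHess f q

theorem IsLocallyLagrange.exists_fibreForm {g : BilinField E N} (hg : IsLocallyLagrange g) :
    ∃ G : TB E N → E →L[ℝ] E →L[ℝ] ℝ, IsLocallyFibreHess G ∧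
      ∀ p (X Y : TTB p), g p X Y = G p (dprojE p Y) (dprojE p X) := by
  choose U hU hpU L hL hgL using hg.2
  have key := fun p => (isHessianOn_iff (hU p) (hL p).1).1 (hgL p)
  -- At each `p` the Lagrangian chosen for `p` itself is used. At `q ∈ U p` both `L p` and `L q`
  -- have the Hessian `g`, and surjectivity of `dπ` forces their fibre Hessians to agree.
  refine ⟨fun p => fibreHess (L p) p, fun p => ⟨U p, hU p, hpU p, L p, (hL p).1, fun q hq => ?_⟩,
    fun p => key p p (hpU p)⟩
  ext u v
  obtain ⟨X, rfl⟩ := dprojE_surjective q v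
  obtain ⟨Y, rfl⟩ := dprojE_surjective q u
  exact (key q q (hpU q) X Y).symm.trans (key p q hq X Y)

/-- The second order Taylor remainder at the origin of a function with second derivative `G`. -/
def taylorRemainder (G : E → E →L[ℝ] E →L[ℝ] ℝ) (y : E) : ℝ :=
  ∫ t in (0 : ℝ)..1, (1 - t) * G (t • y) y y

/-- The function on `TN` that vanishes to second order along the zero section and has the fibrewise
second derivative `G`. -/
def fibreLagrangian (G : TB E N → E →L[ℝ] E →L[ℝ] ℝ) (p : TB E N) : ℝ :=
  taylorRemainder (fun w : E => G (fibreIncl p.proj w)) p.snd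

theorem fibreHess_fibreLagrangian {G : TB E N → E →L[ℝ] E →L[ℝ] ℝ} (hG : IsLocallyFibreHess G)
    (p : TB E N) : fibreHess (fibreLagrangian G) p = G p := by
  have h := fderiv_fderiv_integral_eq (G := fun w : E => G (fibreIncl p.proj w)) fun w => by
    obtain ⟨U, hU, hpU, f, hf, hfG⟩ := hG (fibreIncl p.proj w)
    have hUo := isOpen_fibreIncl_preimage hU p.proj
    refine ⟨fun w => f (fibreIncl p.proj w), (contDiffOn_fibre hf _).contDiffAt (hUo.mem_nhds hpU),
      ?_⟩
    filter_upwards [hUo.mem_nhds hpU] with v hv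
    exact hfG _ hv
  exact congrFun h p.snd

/-- The fibre coordinate is linear on each fibre, so no first derivatives appear in the change of
variables. -/
theorem fderiv_fderiv_fibre_eq {f : TB E N → ℝ} {U : Set (TB E N)} (hU : IsOpen U)
    (hf : ContMDiffOn 𝓘(ℝ, E).tangent 𝓘(ℝ, ℝ) ∞ f U) {x₀ x : N}
    (hx : x ∈ (chartAt E x₀).source) {w : E} (hw : (fibreIncl x w : TB E N) ∈ U) (u v : E) :
    fderiv ℝ (fderiv ℝ fun w : E => f (fibreIncl x w)) w u v =
      fderiv ℝ (fderiv ℝ (f ∘ (natChart x₀).symm)) (natChart x₀ (fibreIncl x w : TB E N))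
        (0, fibreChart x₀ x u) (0, fibreChart x₀ x v) := by
  have hf' := contDiffOn_comp_natChart_symm hf x₀
  have hO := isOpen_natChart_target_inter hU x₀
  have hmem : ∀ w : E, (fibreIncl x w : TB E N) ∈ U → natChart x₀ (fibreIncl x w : TB E N) ∈
      (natChart x₀).target ∩ (natChart x₀).symm ⁻¹' U := fun w hw =>
    ⟨(natChart x₀).map_source (mem_natChart_source.2 hx), by
      rwa [mem_preimage, (natChart x₀).left_inv (mem_natChart_source.2 hx)]⟩
  have heq : (fun w' => fderiv ℝ (fun w : E => f (fibreIncl x w)) w' v) =ᶠ[nhds w]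
      fun w' => fderiv ℝ (f ∘ (natChart x₀).symm) (chartAt E x₀ x, fibreChart x₀ x w')
        (0, fibreChart x₀ x v) := by
    filter_upwards [(isOpen_fibreIncl_preimage hU x).mem_nhds hw] with w' hw'
    rw [fderiv_fibre_eq hx
      ((hf'.contDiffAt (hO.mem_nhds (hmem w' hw'))).differentiableAt (by simp)),
      natChart_apply hx]
  have hd : DifferentiableAt ℝ (fderiv ℝ fun w : E => f (fibreIncl x w)) w :=
    (((contDiffOn_fibre hf x).contDiffAt ((isOpen_fibreIncl_preimage hU x).mem_nhds
      hw)).fderiv_right (m := ∞) (by simp)).differentiableAt (by simp)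
  have h1 : fderiv ℝ (fun w' => fderiv ℝ (fun w : E => f (fibreIncl x w)) w' v) w u
      = fderiv ℝ (fderiv ℝ fun w : E => f (fibreIncl x w)) w u v := by
    rw [fderiv_clm_apply hd (differentiableAt_const v)]
    simp
  have hd' : HasFDerivAt (fderiv ℝ (f ∘ (natChart x₀).symm))
      (fderiv ℝ (fderiv ℝ (f ∘ (natChart x₀).symm)) (chartAt E x₀ x, fibreChart x₀ x w))
      (chartAt E x₀ x, fibreChart x₀ x w) := by
    rw [← natChart_apply hx]
    exact (((hf'.contDiffAt (hO.mem_nhds (hmem w hw))).fderiv_right (m := ∞)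
      (by simp)).differentiableAt (by simp)).hasFDerivAt
  have hc : HasFDerivAt (fun w => (chartAt E x₀ x, fibreChart x₀ x w))
      ((0 : E →L[ℝ] E).prod (fibreChart x₀ x)) w :=
    (hasFDerivAt_const _ _).prodMk (fibreChart x₀ x).hasFDerivAt
  have h2 := (hd'.comp w hc).clm_apply (hasFDerivAt_const (0, fibreChart x₀ x v) w)
  have h3 : fderiv ℝ (fun w' => fderiv ℝ (f ∘ (natChart x₀).symm)
      (chartAt E x₀ x, fibreChart x₀ x w') (0, fibreChart x₀ x v)) w u =
      fderiv ℝ (fderiv ℝ (f ∘ (natChart x₀).symm)) (chartAt E x₀ x, fibreChart x₀ x w)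
        (0, fibreChart x₀ x u) (0, fibreChart x₀ x v) := by
    refine (congrArg (fun A : E →L[ℝ] ℝ => A u) h2.fderiv).trans ?_
    simp
  rw [← h1, heq.fderiv_eq, h3, natChart_apply hx]

theorem fibreHess_natChart_symm {f : TB E N → ℝ} {U : Set (TB E N)} (hU : IsOpen U)
    (hf : ContMDiffOn 𝓘(ℝ, E).tangent 𝓘(ℝ, ℝ) ∞ f U) {x₀ : N} {r : E × E}
    (hr : r ∈ (natChart x₀ : PartialEquiv (TB E N) (E × E)).target)
    (hrU : (natChart x₀).symm r ∈ U) (u v : E) :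
    fibreHess f ((natChart x₀).symm r)
        (fibreChartSymm x₀ ((natChart x₀).symm r : TB E N).proj u)
        (fibreChartSymm x₀ ((natChart x₀).symm r : TB E N).proj v) =
      fderiv ℝ (fderiv ℝ (f ∘ (natChart x₀).symm)) r (0, u) (0, v) := by
  have hx := mem_natChart_source.1 ((natChart x₀).map_target hr)
  have h := fderiv_fderiv_fibre_eq (E := E) hU hf hx (w := ((natChart x₀).symm r).snd) hrU
    (fibreChartSymm x₀ ((natChart x₀).symm r : TB E N).proj u)
    (fibreChartSymm x₀ ((natChart x₀).symm r : TB E N).proj v)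
  rw [fibreChart_fibreChartSymm hx, fibreChart_fibreChartSymm hx] at h
  refine h.trans ?_
  have : natChart x₀ (fibreIncl ((natChart x₀).symm r).proj ((natChart x₀).symm r).snd : TB E N)
    = r := (natChart x₀).right_inv hr
  rw [this]

theorem contMDiff_fibreLagrangian [FiniteDimensional ℝ E] {G : TB E N → E →L[ℝ] E →L[ℝ] ℝ}
    (hG : IsLocallyFibreHess G) :
    ContMDiff 𝓘(ℝ, E).tangent 𝓘(ℝ, ℝ) ∞ (fibreLagrangian G) := by
  intro p
  set x₀ := p.proj
  -- The quadratic form of `G` in coordinates. The base point and the vector are separate variables,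
  -- since the integrand rescales only the base point.
  let k : (E × E) × E → ℝ := fun z => G ((natChart x₀).symm z.1)
    (fibreChartSymm x₀ ((natChart x₀).symm z.1 : TB E N).proj z.2)
    (fibreChartSymm x₀ ((natChart x₀).symm z.1 : TB E N).proj z.2)
  have hT := isOpen_natChart_target (E := E) x₀
  have hk : ContDiffOn ℝ ∞ k ((natChart x₀ : PartialEquiv (TB E N) (E × E)).target ×ˢ univ) := by
    rintro ⟨q, ζ⟩ ⟨hq, -⟩
    obtain ⟨U, hU, hpU, f, hf, hfG⟩ := hG ((natChart x₀).symm q)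
    have hO := isOpen_natChart_target_inter hU x₀
    have hd : ContDiffAt ℝ ∞ (fderiv ℝ (fderiv ℝ (f ∘ (natChart x₀).symm))) q :=
      (((contDiffOn_comp_natChart_symm hf x₀).contDiffAt (hO.mem_nhds ⟨hq, hpU⟩)).fderiv_right
        (m := ∞) (by simp)).fderiv_right (m := ∞) (by simp)
    have hd' : ContDiffAt ℝ ∞ (fun z : (E × E) × E =>
        fderiv ℝ (fderiv ℝ (f ∘ (natChart x₀).symm)) z.1 (0, z.2) (0, z.2)) (q, ζ) :=
      ((hd.comp (q, ζ) contDiffAt_fst).clm_apply (contDiffAt_const.prodMk contDiffAt_snd)).clm_apply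
        (contDiffAt_const.prodMk contDiffAt_snd)
    refine (hd'.congr_of_eventuallyEq ?_).contDiffWithinAt
    filter_upwards [(hO.prod isOpen_univ).mem_nhds
      (show (q, ζ) ∈ _ ×ˢ (univ : Set E) from ⟨⟨hq, hpU⟩, mem_univ ζ⟩)] with z hz
    simp only [k]
    rw [hfG _ hz.1.2, fibreHess_natChart_symm hU hf hz.1.1 hz.1.2]
  have hint : ContDiffOn ℝ ∞ (fun q : E × E => ∫ t in (0 : ℝ)..1,
      (1 - t) * k ((q.1, t • q.2), q.2)) (natChart x₀ : PartialEquiv (TB E N) (E × E)).target := by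
    refine contDiffOn_intervalIntegral hT
      (f := fun z : (E × E) × ℝ => (1 - z.2) * k ((z.1.1, z.2 • z.1.2), z.1.2)) ?_
    refine ContDiffOn.mul (by fun_prop) (hk.comp (by fun_prop) fun z hz => ?_)
    -- The chart domain contains whole fibres, so `(ξ, t • η)` stays in the target for every real
    -- `t`.
    rw [natChart_target] at hz ⊢
    exact ⟨⟨hz.1.1, mem_univ _⟩, mem_univ _⟩
  have hps : p ∈ (natChart x₀ : PartialEquiv (TB E N) (E × E)).source :=
    mem_natChart_source.2 (mem_chart_source E p.proj)
  have hcomp := (hint.contMDiffOn.comp (contMDiffOn_natChart x₀)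
    (fun q hq => (natChart x₀).map_source hq)).contMDiffAt
      ((isOpen_natChart_source x₀).mem_nhds hps)
  refine hcomp.congr_of_eventuallyEq ?_
  filter_upwards [(isOpen_natChart_source x₀).mem_nhds hps] with q hq
  have hx := mem_natChart_source.1 hq
  have hfib : ∀ (x : N) (y : E), x ∈ (chartAt E x₀).source →
      fibreLagrangian G (fibreIncl x y) = ((fun q : E × E => ∫ t in (0 : ℝ)..1,
        (1 - t) * k ((q.1, t • q.2), q.2)) ∘ natChart x₀) (fibreIncl x y : TB E N) := by
    intro x y hx
    simp only [Function.comp_apply]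
    rw [natChart_apply hx]
    refine intervalIntegral.integral_congr fun t _ => ?_
    simp only [k]
    -- Linearity of the fibre coordinate: rescaling in the chart is rescaling in the fibre.
    rw [← map_smul, natChart_symm_fibreChart hx, show (fibreIncl x (t • y) : TB E N).proj = x from
      rfl, fibreChartSymm_fibreChart hx]
    rfl
  exact hfib q.proj q.snd hx

end GlobalLagrangian

/-! ### Lagrangians with the same Hessian. -/

section Compatibility

variable {E : Type*} [NormedAddCommGroup E] [NormedSpace ℝ E]
  {N : Type*} [TopologicalSpace N] [ChartedSpace E N] [IsManifold 𝓘(ℝ, E) ∞ N]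

/-- The pullback to `N` by the chart at `x₀` of the `1`-form `ξ ↦ D ξ` on the model space. -/
def pullbackForm (x₀ : N) (D : E → E →L[ℝ] ℝ) (x : N) : TangentSpace 𝓘(ℝ, E) x →L[ℝ] ℝ :=
  ((D (chartAt E x₀ x)).comp (fibreChart x₀ x : E →L[ℝ] E) : E →L[ℝ] ℝ)

/-- In the trivialization of the cotangent bundle at `x₀` the fibre chart cancels its inverse,
leaving the coefficient `D (chartAt E x₀ x)`. -/
theorem contMDiffOn_pullbackForm {x₀ : N} {D : E → E →L[ℝ] ℝ} {s : Set N}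
    (hs : s ⊆ (chartAt E x₀).source)
    (hD : ContMDiffOn 𝓘(ℝ, E) 𝓘(ℝ, E →L[ℝ] ℝ) ∞ (fun x => D (chartAt E x₀ x)) s) :
    ContMDiffOn 𝓘(ℝ, E) (𝓘(ℝ, E).prod 𝓘(ℝ, E →L[ℝ] ℝ)) ∞
      (fun x => TotalSpace.mk' (E →L[ℝ] ℝ)
        (E := fun x : N => TangentSpace 𝓘(ℝ, E) x →L[ℝ] ℝ) x (pullbackForm x₀ D x)) s := by
  let e := trivializationAt (E →L[ℝ] ℝ)
    (fun x : N => TangentSpace 𝓘(ℝ, E) x →L[ℝ] Bundle.Trivial N ℝ x) x₀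
  have hmaps : MapsTo (fun x => TotalSpace.mk' (E →L[ℝ] ℝ)
      (E := fun x : N => TangentSpace 𝓘(ℝ, E) x →L[ℝ] Bundle.Trivial N ℝ x) x
      (pullbackForm x₀ D x)) s e.source := fun x hx => ⟨hs hx, mem_univ _⟩
  refine (e.contMDiffOn_iff (IB := 𝓘(ℝ, E)) hmaps).2 ⟨contMDiffOn_id, hD.congr fun x hx => ?_⟩
  ext u
  have h : ∀ w : E, fibreChart x₀ x (fibreChartSymm x₀ x w) = w :=
    fibreChart_fibreChartSymm (hs hx)
  change (Bundle.Trivial.trivialization N ℝ).continuousLinearMapAt ℝ x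
    (D (chartAt E x₀ x) (fibreChart x₀ x (fibreChartSymm x₀ x u))) = _
  rw [h, Bundle.Trivial.continuousLinearMapAt_trivialization]
  rfl

theorem areCompatibleOn_of_fibreHess_eq {L L' : TB E N → ℝ} {U : Set (TB E N)} (hU : IsOpen U)
    (hL : ContMDiffOn 𝓘(ℝ, E).tangent 𝓘(ℝ, ℝ) ∞ L U)
    (hL' : ContMDiffOn 𝓘(ℝ, E).tangent 𝓘(ℝ, ℝ) ∞ L' U)
    (h : ∀ p ∈ U, fibreHess L p = fibreHess L' p) : AreCompatibleOn L L' U := by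
  intro p hp
  set x₀ := p.proj
  have hO := isOpen_natChart_target_inter hU x₀
  set F : E × E → ℝ := fun r => (L ∘ (natChart x₀).symm) r - (L' ∘ (natChart x₀).symm) r with hF
  have hFs : ContDiffOn ℝ ∞ F ((natChart x₀).target ∩ (natChart x₀).symm ⁻¹' U) :=
    (contDiffOn_comp_natChart_symm hL x₀).sub (contDiffOn_comp_natChart_symm hL' x₀)
  have hF2 : ∀ r ∈ (natChart x₀).target ∩ (natChart x₀).symm ⁻¹' U, ∀ u v : E,
      fderiv ℝ (fderiv ℝ F) r (0, u) (0, v) = 0 := fun r hr u v => by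
    have hd : ∀ {f : TB E N → ℝ}, ContMDiffOn 𝓘(ℝ, E).tangent 𝓘(ℝ, ℝ) ∞ f U →
        ∀ r ∈ (natChart x₀).target ∩ (natChart x₀).symm ⁻¹' U,
          ContDiffAt ℝ ∞ (f ∘ (natChart x₀).symm) r := fun hf r hr =>
      (contDiffOn_comp_natChart_symm hf x₀).contDiffAt (hO.mem_nhds hr)
    have heq : fderiv ℝ F =ᶠ[nhds r] fun r =>
        fderiv ℝ (L ∘ (natChart x₀).symm) r - fderiv ℝ (L' ∘ (natChart x₀).symm) r := by
      filter_upwards [hO.mem_nhds hr] with r hr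
      exact fderiv_fun_sub ((hd hL r hr).differentiableAt (by simp))
        ((hd hL' r hr).differentiableAt (by simp))
    rw [heq.fderiv_eq, fderiv_fun_sub
      (((hd hL r hr).fderiv_right (m := ∞) (by simp)).differentiableAt (by simp))
      (((hd hL' r hr).fderiv_right (m := ∞) (by simp)).differentiableAt (by simp))]
    simp only [sub_apply]
    rw [← fibreHess_natChart_symm hU hL hr.1 hr.2, ← fibreHess_natChart_symm hU hL' hr.1 hr.2,
      h _ hr.2, sub_self]
  have hps : p ∈ (natChart x₀ : PartialEquiv (TB E N) (E × E)).source :=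
    mem_natChart_source.2 (mem_chart_source E p.proj)
  -- A fibre of `U` need be neither convex nor meet the zero section, hence a product of balls
  -- around the given point and an expansion in `η - η₀`.
  obtain ⟨ρ, hρ, hball⟩ := Metric.isOpen_iff.1 hO (natChart x₀ p)
    ⟨(natChart x₀).map_source hps, by rwa [mem_preimage, (natChart x₀).left_inv hps]⟩
  set ξ₀ := (natChart x₀ p).1
  set η₀ := (natChart x₀ p).2
  have hball' : Metric.ball ξ₀ ρ ×ˢ Metric.ball η₀ ρ ⊆
      (natChart x₀).target ∩ (natChart x₀).symm ⁻¹' U := by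
    rwa [ball_prod_same]
  let D : E → E →L[ℝ] ℝ := fun ξ => (fderiv ℝ F (ξ, η₀)).comp (ContinuousLinearMap.inr ℝ E E)
  have haff : ∀ ξ ∈ Metric.ball ξ₀ ρ, ∀ η ∈ Metric.ball η₀ ρ,
      F (ξ, η) = F (ξ, η₀) + D ξ (η - η₀) := by
    intro ξ hξ η hη
    have hη₀ : η₀ ∈ Metric.ball η₀ ρ := Metric.mem_ball_self hρ
    have hcd : ∀ η ∈ Metric.ball η₀ ρ, ContDiffAt ℝ ∞ F (ξ, η) := fun η hη =>
      hFs.contDiffAt (hO.mem_nhds (hball' ⟨hξ, hη⟩))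
    have hd1 : ∀ η ∈ Metric.ball η₀ ρ, fderiv ℝ (fun η => F (ξ, η)) η =
        (fderiv ℝ F (ξ, η)).comp (ContinuousLinearMap.inr ℝ E E) := fun η hη =>
      (((hcd η hη).differentiableAt (by simp)).hasFDerivAt.comp η
        (hasFDerivAt_prodMk_right ξ η)).fderiv
    have := eq_add_fderiv_of_fderiv_fderiv_eq_zero (f := fun η => F (ξ, η)) Metric.isOpen_ball
      (convex_ball η₀ ρ) (hFs.comp (by fun_prop) fun η hη => hball' ⟨hξ, hη⟩) ?_ hη₀ hη
    · rw [hd1 η₀ hη₀] at this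
      exact this
    · intro η hη
      have heq : fderiv ℝ (fun η => F (ξ, η)) =ᶠ[nhds η]
          fun η => (fderiv ℝ F (ξ, η)).comp (ContinuousLinearMap.inr ℝ E E) := by
        filter_upwards [Metric.isOpen_ball.mem_nhds hη] with η hη using hd1 η hη
      have h2 : HasFDerivAt (fun η => fderiv ℝ F (ξ, η))
          ((fderiv ℝ (fderiv ℝ F) (ξ, η)).comp (ContinuousLinearMap.inr ℝ E E)) η :=
        ((((hcd η hη).fderiv_right (m := ∞) (by simp)).differentiableAt
          (by simp)).hasFDerivAt).comp η (hasFDerivAt_prodMk_right ξ η)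
      rw [heq.fderiv_eq,
        (h2.clm_comp (hasFDerivAt_const (ContinuousLinearMap.inr ℝ E E) η)).fderiv]
      ext u v
      simpa using hF2 (ξ, η) (hball' ⟨hξ, hη⟩) u v
  let W : Set (TB E N) := (natChart x₀).source ∩
    natChart x₀ ⁻¹' (Metric.ball ξ₀ ρ ×ˢ Metric.ball η₀ ρ)
  have hWo : IsOpen W := (contMDiffOn_natChart x₀).continuousOn.isOpen_inter_preimage
    (isOpen_natChart_source x₀) (Metric.isOpen_ball.prod Metric.isOpen_ball)
  have hWU : W ⊆ U := fun q hq => by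
    have := (hball' hq.2).2
    rwa [mem_preimage, (natChart x₀).left_inv hq.1] at this
  have himg : ∀ x ∈ (fun q : TB E N => q.proj) '' W,
      x ∈ (chartAt E x₀).source ∧ chartAt E x₀ x ∈ Metric.ball ξ₀ ρ := by
    rintro _ ⟨q, hq, rfl⟩
    exact ⟨mem_natChart_source.1 hq.1, hq.2.1⟩
  have hchart : ContMDiffOn 𝓘(ℝ, E) 𝓘(ℝ, E × E) ∞ (fun x : N => (chartAt E x₀ x, η₀))
      ((fun q : TB E N => q.proj) '' W) :=
    (contDiff_id.prodMk contDiff_const).contMDiff.comp_contMDiffOn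
      ((contMDiffOn_chart (I := 𝓘(ℝ, E)) (n := ∞)).mono fun x hx => (himg x hx).1)
  have hmaps : MapsTo (fun x : N => (chartAt E x₀ x, η₀)) ((fun q : TB E N => q.proj) '' W)
      ((natChart x₀).target ∩ (natChart x₀).symm ⁻¹' U) := fun x hx =>
    hball' ⟨(himg x hx).2, Metric.mem_ball_self hρ⟩
  have hDs : ContMDiffOn 𝓘(ℝ, E) 𝓘(ℝ, E →L[ℝ] ℝ) ∞ (fun x => D (chartAt E x₀ x))
      ((fun q : TB E N => q.proj) '' W) :=
    ((hFs.fderiv_of_isOpen hO (m := ∞) (by simp)).clm_comp contDiffOn_const).contMDiffOn.comp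
      hchart hmaps
  -- The affine expansion `F (ξ, η₀) + D ξ (η - η₀)` is split into its linear part in `η`, giving
  -- the form, and the remainder, giving `b`.
  refine ⟨W, hWo, ⟨hps, Metric.mem_ball_self hρ, Metric.mem_ball_self hρ⟩, hWU,
    pullbackForm x₀ D, fun x => F (chartAt E x₀ x, η₀) - D (chartAt E x₀ x) η₀,
    contMDiffOn_pullbackForm (fun x hx => (himg x hx).1) hDs, ?_, fun q hq => ?_⟩
  · exact (hFs.contMDiffOn.comp hchart hmaps).sub (hDs.clm_apply contMDiffOn_const)
  · have h1 := haff _ hq.2.1 _ hq.2.2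
    have h2 : F (natChart x₀ q) = L q - L' q := by
      simp only [hF, Function.comp_apply]
      rw [(natChart x₀).left_inv hq.1]
    have h3 : natChart x₀ q = (chartAt E x₀ q.proj, fibreChart (E := E) x₀ q.proj q.snd) :=
      natChart_apply (mem_natChart_source.1 hq.1) q.snd
    have h4 : pullbackForm x₀ D q.proj q.snd
      = D (chartAt E x₀ q.proj) (fibreChart (E := E) x₀ q.proj q.snd) := rfl
    rw [h4, ← h2]
    refine h1.trans ?_
    rw [h3, map_sub]
    ring

end Compatibility

end LagrangeGeometry

end

theorem proposition2p6 {E : Type*} [NormedAddCommGroup E] [NormedSpace ℝ E] [FiniteDimensional ℝ E]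
    {N : Type*} [TopologicalSpace N] [ChartedSpace E N] [IsManifold 𝓘(ℝ, E) ∞ N]
    (g : LagrangeGeometry.BilinField E N) (hg : LagrangeGeometry.IsLocallyLagrange g) :
    LagrangeGeometry.IsGloballyLagrange g := by
  open LagrangeGeometry in
  obtain ⟨G, hG, hgG⟩ := hg.exists_fibreForm
  have hsm := contMDiff_fibreLagrangian hG
  have hess : IsHessianOn (fibreLagrangian G) univ g :=
    (isHessianOn_iff isOpen_univ hsm.contMDiffOn).2 fun p _ X Y => by
      rw [fibreHess_fibreLagrangian hG, hgG]
  refine ⟨hg.1, fibreLagrangian G, ⟨hsm.contMDiffOn, g, hess, hg.1.nondegenerate⟩, hess,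
    fun U L' hU hL' hgL' => ?_⟩
  refine areCompatibleOn_of_fibreHess_eq hU hsm.contMDiffOn hL'.1 fun p hp => ?_
  rw [fibreHess_fibreLagrangian hG]
  ext u v
  obtain ⟨X, rfl⟩ := dprojE_surjective p v
  obtain ⟨Y, rfl⟩ := dprojE_surjective p u
  exact (hgG p X Y).symm.trans ((isHessianOn_iff hU hL'.1).1 hgL' p hp X Y)
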